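/- All rings are associative with $1$ and need not be commutative; all modules are unitary left modules. A module is \emph{distributive} if its lattice of submodules is distributive. The \emph{inner rank} $\operatorname{rk}(a)$ of a $k\times k$ matrix $a$ over a ring $R$ is the least $p\ge 0$ such that $a=bc$ for some $k\times p$ matrix $b$ and $p\times k$ matrix $c$ over $R$ (so $\operatorname{rk}(a)=0$ if and only if $a=0$). A matrix $r=(r_{ij})\in R^{k\times k}$ acts on $x=(x_1,\dots,x_k)\in A^k$ by $(rx)_i=\sum_{j=1}^k r_{ij}x_j$. \textbf{Theorem.} Let $R$ be a ring with Jacobson radical $J(R)$ such that $R/J(R)$ is a semisimple ring (for example, any finite or left Artinian ring), and let $n\ge 0$ be an integer such that $J(R)^n=0$. Let $A$ be a finite distributive $R$-module, let $S$ be a ring in which $|A|$ is invertible, and let $B$ be an $S$-module. Then for every integer $k\ge 0$ there exists a finitely supported function $$s\colon \{r\in R^{k\times k} : \operatorname{rk}(r)\le n\}\to S$$ such that for all functions $f\colon A^k\to B$ and all $x\in A^k$, $$f(x)=\sum_{r\in R^{k\times k},\ \operatorname{rk}(r)\le n} s(r)\, f(rx).$$ -/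

import Mathlib

/-- A module is distributive if its lattice of submodules is distributive. -/
def IsDistributiveModule (R A : Type*) [Ring R] [AddCommGroup A] [Module R A] : Prop :=
  ∀ X Y Z : Submodule R A, X ⊓ (Y ⊔ Z) = (X ⊓ Y) ⊔ (X ⊓ Z)

/-- The inner rank of an `l × m` matrix `a`: the least `p` such that `a = b * c` with `b` of size
`l × p` and `c` of size `p × m`. A product with `p = 0` is the zero matrix, so the zero matrix, and
no other matrix, has inner rank `0`. -/
noncomputable def innerRank {R : Type*} [Ring R] {l m : ℕ} (a : Matrix (Fin l) (Fin m) R) : ℕ :=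
  sInf {p : ℕ | ∃ (b : Matrix (Fin l) (Fin p) R) (c : Matrix (Fin p) (Fin m) R), a = b * c}

/-- The action `(r x)_i = ∑ j, r_ij x_j` of a `k × k` matrix over `R` on `A ^ k`. -/
def matAct {R A : Type*} [Ring R] [AddCommGroup A] [Module R A] {k : ℕ}
    (r : Matrix (Fin k) (Fin k) R) (x : Fin k → A) : Fin k → A :=
  fun i => ∑ j, r i j • x j

/-! The monoid algebra over `S` of the `k × k` matrices acts on the free module on `A^k`. The
theorem asks for an element supported on matrices of inner rank at most `n` that acts as the
identity (`Fixes`). The centre of `S` contains the inverse of `|A|`, so `S` may be taken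
commutative.

Simple `A`: here `A^k` is a finite vector space over the division ring `End_R A`. Counting
functionals gives an interpolation formula by operators of rank at most one, and the density theorem
realises these operators by matrices factoring through `R` (`exists_fixes_of_isSimpleModule`).

Semisimple `A`: distributivity forbids nonzero maps between disjoint submodules. Projections onto
summands are therefore scalars from `R`, and these glue the matrices for two complementary summands
without raising the rank (`exists_fixes_of_isCompl`).

General `A`, with `J` the Jacobson radical: let `a` average over the action of `1 + M_k(J)`. It
spreads `x` uniformly over `x + (JX)^k`, where `X` is the span of the entries of `x`, and it acts
idempotently. Choose `e` of rank one fixing every `X/JX` simultaneously. Then `a - ae` strictly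
shrinks spans, so it acts nilpotently; expanding a high power shows that `a` acts as a rank-one
combination (`exists_lowRank_fnAct_eq`).

This gives a rank-one formula correct modulo `JA`. Induction on `n` supplies `u` for `JA`, and `r +
u(1 - r)` corrects the error `x - rx`; each layer of the radical costs one unit of rank. -/

/-! ### Matrix action on `A^k`, and factorization of matrices. -/

section MatAct

variable {R A : Type*} [Ring R] [AddCommGroup A] [Module R A] {k : ℕ}

theorem matAct_apply (r : Matrix (Fin k) (Fin k) R) (x : Fin k → A) (i : Fin k) :
    matAct r x i = ∑ j, r i j • x j := rfl

theorem matAct_one (x : Fin k → A) : matAct (1 : Matrix (Fin k) (Fin k) R) x = x := by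
  ext i
  simp [matAct_apply, Matrix.one_apply, ite_smul]

theorem matAct_add_left (r u : Matrix (Fin k) (Fin k) R) (x : Fin k → A) :
    matAct (r + u) x = matAct r x + matAct u x := by
  ext i
  simp [matAct_apply, add_smul, Finset.sum_add_distrib]

theorem matAct_sub_left (r u : Matrix (Fin k) (Fin k) R) (x : Fin k → A) :
    matAct (r - u) x = matAct r x - matAct u x := by
  ext i
  simp [matAct_apply, sub_smul, Finset.sum_sub_distrib]

theorem matAct_mul (r u : Matrix (Fin k) (Fin k) R) (x : Fin k → A) :
    matAct (r * u) x = matAct r (matAct u x) := by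
  ext i
  simp only [matAct_apply, Matrix.mul_apply, Finset.sum_smul, Finset.smul_sum, mul_smul]
  exact Finset.sum_comm

theorem matAct_comp {A' : Type*} [AddCommGroup A'] [Module R A'] (φ : A →ₗ[R] A')
    (r : Matrix (Fin k) (Fin k) R) (x : Fin k → A) :
    matAct r (φ ∘ x) = φ ∘ matAct r x := by
  ext i
  simp [matAct_apply]

theorem matAct_mem (X : Submodule R A) (r : Matrix (Fin k) (Fin k) R) {x : Fin k → A}
    (hx : ∀ i, x i ∈ X) (i : Fin k) : matAct r x i ∈ X :=
  Submodule.sum_mem _ fun j _ => X.smul_mem _ (hx j)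

end MatAct

/-- The matrix `r` factors through a free module of rank `p`. -/
def FactorsThrough {R : Type*} [Ring R] {k : ℕ} (p : ℕ) (r : Matrix (Fin k) (Fin k) R) : Prop :=
  ∃ (b : Matrix (Fin k) (Fin p) R) (c : Matrix (Fin p) (Fin k) R), r = b * c

section FactorsThrough

variable {R : Type*} [Ring R] {k p q : ℕ} {r u : Matrix (Fin k) (Fin k) R}

theorem FactorsThrough.innerRank_le (h : FactorsThrough p r) : innerRank r ≤ p :=
  Nat.sInf_le h

theorem FactorsThrough.mul_right (h : FactorsThrough p r) (u : Matrix (Fin k) (Fin k) R) :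
    FactorsThrough p (r * u) := by
  obtain ⟨b, c, rfl⟩ := h
  exact ⟨b, c * u, Matrix.mul_assoc _ _ _⟩

theorem FactorsThrough.mul_left (h : FactorsThrough p r) (u : Matrix (Fin k) (Fin k) R) :
    FactorsThrough p (u * r) := by
  obtain ⟨b, c, rfl⟩ := h
  exact ⟨u * b, c, (Matrix.mul_assoc _ _ _).symm⟩

theorem FactorsThrough.zero (p : ℕ) : FactorsThrough p (0 : Matrix (Fin k) (Fin k) R) :=
  ⟨0, 0, by simp⟩

/-- Block matrices: `[b b']` times the column of `c` and `c'` is `bc + b'c'`. -/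
theorem FactorsThrough.add (hr : FactorsThrough p r) (hu : FactorsThrough q u) :
    FactorsThrough (p + q) (r + u) := by
  obtain ⟨b, c, rfl⟩ := hr
  obtain ⟨b', c', rfl⟩ := hu
  refine ⟨(Matrix.fromCols b b').submatrix id finSumFinEquiv.symm,
    (Matrix.fromRows c c').submatrix finSumFinEquiv.symm id, ?_⟩
  rw [Matrix.submatrix_mul_equiv, Matrix.fromCols_mul_fromRows, Matrix.submatrix_id_id]

end FactorsThrough

/-! ### Linear extension of functions to the monoid algebra. -/

section MonoidAlgebraEval

variable {S M N N' : Type*} [CommRing S] [AddCommGroup N] [Module S N] [AddCommGroup N']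
  [Module S N']

/-- The linear extension to `S[M]` of a function on `M`. -/
noncomputable def algEval (g : M → N) : MonoidAlgebra S M →ₗ[S] N where
  toFun e := e.coeff.sum fun r s => s • g r
  map_add' e e' := by
    rw [MonoidAlgebra.coeff_add]
    exact Finsupp.sum_add_index' (by simp) (by simp [add_smul])
  map_smul' c e := by
    rw [MonoidAlgebra.coeff_smul, Finsupp.sum_smul_index' (by simp)]
    simp [Finsupp.smul_sum, mul_smul]

theorem algEval_apply (g : M → N) (e : MonoidAlgebra S M) :
    algEval g e = e.coeff.sum fun r s => s • g r := rfl

@[simp]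
theorem algEval_single (g : M → N) (r : M) (s : S) :
    algEval g (MonoidAlgebra.single r s) = s • g r := by
  simp [algEval_apply]

theorem map_algEval (T : N →ₗ[S] N') (g : M → N) (e : MonoidAlgebra S M) :
    T (algEval g e) = algEval (fun r => T (g r)) e := by
  simp [algEval_apply, map_finsuppSum]

theorem algEval_congr {g g' : M → N} {e : MonoidAlgebra S M}
    (h : ∀ r ∈ e.coeff.support, g r = g' r) :
    algEval g e = algEval g' e := by
  rw [algEval_apply, algEval_apply]
  exact Finsupp.sum_congr fun r hr => by simp only [h r hr]

theorem algEval_mem (P : Submodule S N) {g : M → N} (e : MonoidAlgebra S M)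
    (h : ∀ r ∈ e.coeff.support, g r ∈ P) : algEval g e ∈ P :=
  Submodule.sum_mem _ fun r hr => P.smul_mem _ (h r hr)

theorem algEval_sub_fun (g g' : M → N) (e : MonoidAlgebra S M) :
    algEval (fun r => g r - g' r) e = algEval g e - algEval g' e := by
  simp [algEval_apply, smul_sub, Finsupp.sum_sub]

/-- The bilinear extension to `S[M]` of a binary operation on `M`. -/
noncomputable def algComb (F : M → M → M) (e e' : MonoidAlgebra S M) : MonoidAlgebra S M :=
  algEval (fun r => algEval (fun r' => MonoidAlgebra.single (F r r') (1 : S)) e') e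

theorem algEval_algComb (g : M → N) (F : M → M → M) (e e' : MonoidAlgebra S M) :
    algEval g (algComb F e e') = algEval (fun r => algEval (fun r' => g (F r r')) e') e := by
  simp [algComb, map_algEval]

theorem mul_eq_algEval [Monoid M] (e e' : MonoidAlgebra S M) :
    e * e' = algEval (fun r => algEval (fun r' => MonoidAlgebra.single (r * r') (1 : S)) e') e := by
  rw [MonoidAlgebra.mul_def]
  simp [algEval_apply, Finsupp.smul_sum]

end MonoidAlgebraEval

/-! ### The two-sided ideal of low-rank combinations. -/

section LowRank

variable (S : Type*) {R : Type*} [CommRing S] [Ring R] {k : ℕ}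

/-- The combinations of matrices which factor through a free module of rank `p`. -/
def lowRank (R : Type*) [Ring R] (k p : ℕ) :
    Submodule S (MonoidAlgebra S (Matrix (Fin k) (Fin k) R)) where
  carrier := {e | ∀ r ∈ e.coeff.support, FactorsThrough p r}
  zero_mem' := by simp
  add_mem' := by
    intro e e' he he' r hr
    classical
    rcases Finset.mem_union.1 (Finsupp.support_add hr) with h | h
    exacts [he r h, he' r h]
  smul_mem' c e he r hr := he r (Finsupp.support_smul hr)

variable {S}

theorem single_mem_lowRank {p : ℕ} {r : Matrix (Fin k) (Fin k) R} (h : FactorsThrough p r) (s : S) :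
    MonoidAlgebra.single r s ∈ lowRank S R k p := by
  intro u hu
  have := Finsupp.support_single_subset hu
  rw [Finset.mem_singleton] at this
  exact this ▸ h

theorem mul_mem_lowRank_left {p : ℕ} {e : MonoidAlgebra S (Matrix (Fin k) (Fin k) R)}
    (he : e ∈ lowRank S R k p) (e' : MonoidAlgebra S (Matrix (Fin k) (Fin k) R)) :
    e * e' ∈ lowRank S R k p := by
  rw [mul_eq_algEval]
  exact algEval_mem _ _ fun r hr => algEval_mem _ _ fun r' _ =>
    single_mem_lowRank ((he r hr).mul_right r') 1

theorem mul_mem_lowRank_right {p : ℕ} {e' : MonoidAlgebra S (Matrix (Fin k) (Fin k) R)}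
    (e : MonoidAlgebra S (Matrix (Fin k) (Fin k) R)) (he' : e' ∈ lowRank S R k p) :
    e * e' ∈ lowRank S R k p := by
  rw [mul_eq_algEval]
  exact algEval_mem _ _ fun r _ => algEval_mem _ _ fun r' hr' =>
    single_mem_lowRank ((he' r' hr').mul_left r) 1

theorem algComb_mem_lowRank {p q t : ℕ} {e e' : MonoidAlgebra S (Matrix (Fin k) (Fin k) R)}
    (he : e ∈ lowRank S R k p) (he' : e' ∈ lowRank S R k q)
    {F : Matrix (Fin k) (Fin k) R → Matrix (Fin k) (Fin k) R → Matrix (Fin k) (Fin k) R}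
    (hF : ∀ r r', FactorsThrough p r → FactorsThrough q r' → FactorsThrough t (F r r')) :
    algComb F e e' ∈ lowRank S R k t :=
  algEval_mem _ _ fun r hr => algEval_mem _ _ fun r' hr' =>
    single_mem_lowRank (hF r r' (he r hr) (he' r' hr')) 1

end LowRank

/-! ### The action on the free module on `A^k`. -/

section FnAct

variable (S A : Type*) {R : Type*} [CommRing S] [Ring R] [AddCommGroup A] [Module R A] {k : ℕ}

/-- The linear action of the monoid algebra of matrices on the free module on `A ^ k`. -/
noncomputable def fnAct : MonoidAlgebra S (Matrix (Fin k) (Fin k) R) →ₐ[S]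
    Module.End S ((Fin k → A) →₀ S) :=
  MonoidAlgebra.lift S _ _
    { toFun := fun r => Finsupp.lmapDomain S S (matAct r)
      map_one' := by
        ext x : 2
        simp [matAct_one]
      map_mul' := fun r u => by
        ext x : 2
        simp [matAct_mul] }

variable {S A}

theorem fnAct_single (e : MonoidAlgebra S (Matrix (Fin k) (Fin k) R)) (x : Fin k → A) :
    fnAct S A e (Finsupp.single x 1) = algEval (fun r => Finsupp.single (matAct r x) 1) e := by
  simp [fnAct, MonoidAlgebra.lift_apply, algEval_apply, Finsupp.sum, LinearMap.sum_apply]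

variable (A) in
/-- The combination `e` of matrices acts as the identity on the free module on `A ^ k`. -/
def Fixes (e : MonoidAlgebra S (Matrix (Fin k) (Fin k) R)) : Prop := fnAct S A e = 1

theorem fnAct_eq_algEval {N : Type*} [AddCommGroup N] [Module S N]
    (e : MonoidAlgebra S (Matrix (Fin k) (Fin k) R)) (x : Fin k → A) (g : (Fin k → A) → N) :
    Finsupp.linearCombination S g (fnAct S A e (Finsupp.single x 1)) =
      algEval (fun r => g (matAct r x)) e := by
  rw [fnAct_single, map_algEval]
  simp

theorem Fixes.algEval {N : Type*} [AddCommGroup N] [Module S N]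
    {e : MonoidAlgebra S (Matrix (Fin k) (Fin k) R)} (h : Fixes A e) (x : Fin k → A)
    (g : (Fin k → A) → N) : algEval (fun r => g (matAct r x)) e = g x := by
  rw [← fnAct_eq_algEval, h]
  simp

theorem fixes_of_forall {e : MonoidAlgebra S (Matrix (Fin k) (Fin k) R)}
    (h : ∀ x : Fin k → A, algEval (fun r => Finsupp.single (matAct r x) (1 : S)) e =
      Finsupp.single x 1) : Fixes A e := by
  refine Finsupp.lhom_ext' fun x => LinearMap.ext_ring ?_
  simpa [fnAct_single] using h x

theorem fixes_single_zero [Subsingleton A] :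
    Fixes A (MonoidAlgebra.single (0 : Matrix (Fin k) (Fin k) R) (1 : S)) :=
  fixes_of_forall fun x => by
    rw [algEval_single, one_smul, Subsingleton.elim (matAct 0 x) x]

theorem fnAct_mul_single (e e' : MonoidAlgebra S (Matrix (Fin k) (Fin k) R)) (x : Fin k → A) :
    fnAct S A (e * e') (Finsupp.single x 1) =
      algEval (fun r => fnAct S A e (Finsupp.single (matAct r x) 1)) e' := by
  rw [map_mul, Module.End.mul_apply, fnAct_single, map_algEval]

end FnAct

/-- The element `e + e' - ee' = 1 - (1 - e)(1 - e')` acts as the identity wherever `e` or `e'` does,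
and it stays in the ideal. -/
theorem exists_uniform_fixes {S R ι : Type*} [CommRing S] [Ring R] {k p : ℕ} (M : ι → Type*)
    [∀ i, AddCommGroup (M i)] [∀ i, Module R (M i)] [Finite ι]
    (h : ∀ i, ∃ e ∈ lowRank S R k p, Fixes (M i) e) :
    ∃ e ∈ lowRank S R k p, ∀ i, Fixes (M i) e := by
  classical
  cases nonempty_fintype ι
  suffices H : ∀ s : Finset ι, ∃ e ∈ lowRank S R k p, ∀ i ∈ s, Fixes (M i) e by
    obtain ⟨e, he, h⟩ := H Finset.univ
    exact ⟨e, he, fun i => h i (Finset.mem_univ i)⟩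
  intro s
  induction s using Finset.induction_on with
  | empty => exact ⟨0, Submodule.zero_mem _, by simp⟩
  | insert i s _ ih =>
    obtain ⟨e, he, hes⟩ := ih
    obtain ⟨e', he', hei⟩ := h i
    refine ⟨e + e' - e * e', Submodule.sub_mem _ (Submodule.add_mem _ he he')
      (mul_mem_lowRank_left he e'), fun j hj => ?_⟩
    rcases Finset.mem_insert.1 hj with rfl | hj
    · have : fnAct S (M j) e' = 1 := hei
      have h1 : e + e' - e * e' = e' + e * (1 - e') := by rw [mul_sub, mul_one]; abel
      have h2 : fnAct S (M j) (1 - e') = 0 := by simp [this]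
      rw [Fixes, h1, map_add, map_mul, h2, mul_zero, add_zero, this]
    · have : fnAct S (M j) e = 1 := hes j hj
      have h1 : e + e' - e * e' = e + (1 - e) * e' := by rw [sub_mul, one_mul]; abel
      have h2 : fnAct S (M j) (1 - e) = 0 := by simp [this]
      rw [Fixes, h1, map_add, map_mul, h2, zero_mul, add_zero, this]

/-! ### Rank-one interpolation on a finite vector space. -/

section RankOne

variable {K V : Type*} [DivisionRing K] [AddCommGroup V] [Module K V]

theorem exists_functional_apply_eq_one {z : V} (hz : z ≠ 0) : ∃ f : V →ₗ[K] K, f z = 1 := by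
  obtain ⟨f, hf⟩ := IsSemisimpleModule.extension_property (LinearMap.toSpanSingleton K V z)
    (LinearMap.ker_eq_bot.1 (LinearMap.ker_toSpanSingleton K hz)) (LinearMap.id : K →ₗ[K] K)
  exact ⟨f, by simpa using LinearMap.congr_fun hf 1⟩

theorem exists_functional_of_notMem_span {x y : V} (h : y ∉ Submodule.span K {x}) :
    ∃ f : V →ₗ[K] K, f x = 0 ∧ f y = 1 := by
  obtain ⟨f, hf⟩ := exists_functional_apply_eq_one (K := K)
    (z := (Submodule.span K {x}).mkQ y) (by simpa using h)
  refine ⟨f ∘ₗ (Submodule.span K {x}).mkQ, ?_, hf⟩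
  have : (Submodule.span K {x}).mkQ x = 0 := by simp [Submodule.mem_span_singleton_self]
  rw [LinearMap.comp_apply, this, map_zero]

/-- The operators `z ↦ ξ z • v` with `ξ v = t`. -/
def rankOneSet (K V : Type*) [DivisionRing K] [AddCommGroup V] [Module K V] (t : K) :
    Set (V →ₗ[K] V) :=
  {r | ∃ (ξ : V →ₗ[K] K) (v : V), ξ v = t ∧ r = ξ.smulRight v}

/-- A rank-one operator taking `x` to `y ≠ 0` is uniquely `ξ ⊗ y` with `ξ x = 1`. Normalising `ξ ⊗
v` to this form conjugates `ξ v` by `ξ x`, which is harmless for `t` equal to `0` or `1`. -/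
theorem ncard_rankOneSet_apply_eq {t : K} (ht : t = 0 ∨ t = 1) (x : V) {y : V} (hy : y ≠ 0) :
    {r ∈ rankOneSet K V t | r x = y}.ncard = {ξ : V →ₗ[K] K | ξ x = 1 ∧ ξ y = t}.ncard := by
  symm
  refine Set.ncard_congr (fun ξ _ => ξ.smulRight y) ?_ ?_ ?_
  · rintro ξ ⟨hx, hξ⟩
    exact ⟨⟨ξ, y, hξ, rfl⟩, by simp [hx]⟩
  · intro ξ ξ' _ _ h
    ext z
    exact smul_left_injective K hy (LinearMap.congr_fun h z)
  · rintro r ⟨⟨ξ, v, hv, rfl⟩, hr⟩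
    have hr : ξ x • v = y := hr
    have hξ : ξ x ≠ 0 := by
      intro h
      rw [h, zero_smul] at hr
      exact hy hr.symm
    refine ⟨ξ.smulRight (ξ x)⁻¹, ⟨by simp [hξ], ?_⟩, ?_⟩
    · rw [← hr]
      rcases ht with rfl | rfl <;> simp [hv, hξ]
    · ext z
      simp [← hr, smul_smul, hξ]

/-- If `y` is outside the line of `x`, translation by a functional killing `x` and taking `y` to `1`
is a bijection. If `y = a • x` with `a` neither `0` nor `1`, both sets are empty. -/
theorem ncard_functional_eq_of_ne [Finite V] {x y : V} (hxy : y ≠ x) (hy : y ≠ 0) :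
    {ξ : V →ₗ[K] K | ξ x = 1 ∧ ξ y = 1}.ncard = {ξ : V →ₗ[K] K | ξ x = 1 ∧ ξ y = 0}.ncard := by
  by_cases h : y ∈ Submodule.span K {x}
  · obtain ⟨a, rfl⟩ := Submodule.mem_span_singleton.1 h
    have h1 : {ξ : V →ₗ[K] K | ξ x = 1 ∧ ξ (a • x) = 1} = ∅ := by
      refine Set.eq_empty_of_forall_notMem ?_
      rintro ξ ⟨hx, hξ⟩
      rw [map_smul, hx, smul_eq_mul, mul_one] at hξ
      exact hxy (by rw [hξ, one_smul])
    have h0 : {ξ : V →ₗ[K] K | ξ x = 1 ∧ ξ (a • x) = 0} = ∅ := by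
      refine Set.eq_empty_of_forall_notMem ?_
      rintro ξ ⟨hx, hξ⟩
      rw [map_smul, hx, smul_eq_mul, mul_one] at hξ
      exact hy (by rw [hξ, zero_smul])
    rw [h1, h0]
  · obtain ⟨f, hfx, hfy⟩ := exists_functional_of_notMem_span h
    refine Set.ncard_congr (fun ξ _ => ξ - f) ?_ ?_ ?_
    · rintro ξ ⟨hx, hξ⟩
      simp [hx, hξ, hfx, hfy]
    · intro ξ ξ' _ _ h
      simpa using h
    · rintro ξ ⟨hx, hξ⟩
      exact ⟨ξ + f, by simp [hx, hξ, hfx, hfy], by simp⟩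

/-- Evaluation at `x ≠ 0` maps the dual onto `K`, and all its fibres are translates of the one over
`1`. -/
theorem card_functional_eq_mul_ncard [Finite V] [Finite K] {x : V} (hx : x ≠ 0) :
    Nat.card (V →ₗ[K] K) = Nat.card K * {ξ : V →ₗ[K] K | ξ x = 1}.ncard := by
  obtain ⟨f, hf⟩ := exists_functional_apply_eq_one (K := K) hx
  rw [← Nat.card_coe_set_eq, ← Nat.card_prod]
  refine Nat.card_congr
    { toFun := fun ξ => (ξ x, ⟨ξ - f.smulRight (ξ x - 1), by simp [hf]⟩)
      invFun := fun p => p.2.1 + f.smulRight (p.1 - 1)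
      left_inv := fun ξ => by simp
      right_inv := ?_ }
  rintro ⟨a, ξ, hξ⟩
  have hξ : ξ x = 1 := hξ
  simp [hf, hξ]

end RankOne

theorem sum_single_apply_eq_ncard {α β S : Type*} [CommRing S] (s : Finset α) (f : α → β) (b : β) :
    (∑ r ∈ s, Finsupp.single (f r) (1 : S)) b = ({r ∈ (s : Set α) | f r = b}.ncard : S) := by
  classical
  have : {r ∈ (s : Set α) | f r = b} = (s.filter fun r => f r = b : Finset α) := by
    ext; simp
  rw [this, Set.ncard_coe_finset, Finset.card_filter, Finsupp.finsetSum_apply]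
  simp [Finsupp.single_apply]

/-- A uniform interpolation formula by operators of rank at most one on a finite vector space. -/
theorem exists_rankOne_interpolation {K V S : Type*} [DivisionRing K] [AddCommGroup V]
    [Module K V] [CommRing S] [Finite V] [Finite K] (hS : IsUnit (Nat.card (V →ₗ[K] K) : S)) :
    ∃ e ∈ Submodule.span S ((fun r => MonoidAlgebra.single r (1 : S)) ''
        {r : V →ₗ[K] V | ∃ (ξ : V →ₗ[K] K) (v : V), r = ξ.smulRight v}),
      ∀ x : V, algEval (fun r : V →ₗ[K] V => Finsupp.single (r x) (1 : S)) e =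
        Finsupp.single x 1 := by
  classical
  have : Finite (V →ₗ[K] V) := Finite.of_injective _ DFunLike.coe_injective
  set P := Submodule.span S ((fun r => MonoidAlgebra.single r (1 : S)) ''
        {r : V →ₗ[K] V | ∃ (ξ : V →ₗ[K] K) (v : V), r = ξ.smulRight v})
  obtain ⟨u, hu⟩ := hS.exists_left_inv
  let Ω : K → Finset (V →ₗ[K] V) := fun t => (Set.toFinite (rankOneSet K V t)).toFinset
  have hΩ : ∀ t, (Ω t : Set (V →ₗ[K] V)) = rankOneSet K V t := fun t => by simp [Ω]
  let s : K → MonoidAlgebra S (V →ₗ[K] V) := fun t =>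
    ∑ r ∈ Ω t, MonoidAlgebra.single r (1 : S)
  have hs : ∀ t, s t ∈ P := fun t => Submodule.sum_mem _ fun r hr => by
    obtain ⟨ξ, v, -, rfl⟩ : r ∈ rankOneSet K V t := by rw [← hΩ]; exact hr
    exact Submodule.subset_span ⟨_, ⟨ξ, v, rfl⟩, rfl⟩
  -- Applied to `x ≠ 0`, the difference `s 1 - s 0` has coefficient `0` at every `y` other than `0`
  -- and `x`, and `|V*|/|K|` at `x`; the scalar normalises the latter to `1`.
  let e₀ := (u * (Nat.card K : S)) • (s 1 - s 0)
  let ε : MonoidAlgebra S (V →ₗ[K] V) →ₗ[S] S := algEval fun _ => (1 : S)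
  -- A multiple of the zero operator changes only the coefficient at the vector `0`; it is chosen to
  -- make the total mass `1`, which then determines that coefficient.
  let e := e₀ + (1 - ε e₀) • MonoidAlgebra.single (0 : V →ₗ[K] V) (1 : S)
  have heval : ∀ x, algEval (fun r : V →ₗ[K] V => Finsupp.single (r x) (1 : S)) e =
      algEval (fun r : V →ₗ[K] V => Finsupp.single (r x) (1 : S)) e₀ +
        Finsupp.single 0 (1 - ε e₀) := fun x => by simp [e]
  have haug : ∀ x, Finsupp.linearCombination S (fun _ : V => (1 : S))
      (algEval (fun r : V →ₗ[K] V => Finsupp.single (r x) (1 : S)) e) = 1 := fun x => by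
    rw [heval, map_add, map_algEval]
    simp [ε]
  have hval : ∀ x y, x ≠ 0 → y ≠ 0 →
      algEval (fun r : V →ₗ[K] V => Finsupp.single (r x) (1 : S)) e y =
        Finsupp.single x (1 : S) y := by
    intro x y hx hy
    have hst : ∀ t : K, t = 0 ∨ t = 1 →
        algEval (fun r : V →ₗ[K] V => Finsupp.single (r x) (1 : S)) (s t) y =
          ({ξ : V →ₗ[K] K | ξ x = 1 ∧ ξ y = t}.ncard : S) := by
      intro t ht
      rw [← ncard_rankOneSet_apply_eq ht x hy, ← hΩ t]
      simp only [s, map_sum, algEval_single, one_smul]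
      exact sum_single_apply_eq_ncard _ _ _
    rw [heval, Finsupp.add_apply, Finsupp.single_eq_of_ne hy, add_zero, map_smul, map_sub,
      Finsupp.smul_apply, Finsupp.sub_apply, hst 1 (.inr rfl), hst 0 (.inl rfl)]
    by_cases hxy : y = x
    · subst hxy
      have h0 : {ξ : V →ₗ[K] K | ξ y = 1 ∧ ξ y = 0} = ∅ := by
        refine Set.eq_empty_of_forall_notMem ?_
        rintro ξ ⟨h1, h0⟩
        exact one_ne_zero (h1.symm.trans h0)
      rw [h0, Finsupp.single_eq_same]
      simp only [and_self, Set.ncard_empty, Nat.cast_zero, sub_zero, smul_eq_mul]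
      rw [mul_assoc, ← Nat.cast_mul, ← card_functional_eq_mul_ncard hx, hu]
    · rw [ncard_functional_eq_of_ne hxy hy, sub_self, smul_zero, Finsupp.single_eq_of_ne hxy]
  refine ⟨e, ?_, fun x => ?_⟩
  · exact P.add_mem (P.smul_mem _ (P.sub_mem (hs 1) (hs 0)))
      (P.smul_mem _ (Submodule.subset_span ⟨0, ⟨0, 0, by simp⟩, rfl⟩))
  · have key : ∀ w : V →₀ S, (∀ y, y ≠ 0 → w y = Finsupp.single x (1 : S) y) →
        Finsupp.linearCombination S (fun _ : V => (1 : S)) w = 1 → w = Finsupp.single x 1 := by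
      intro w hw h1
      obtain ⟨t, ht⟩ : ∃ t, w = Finsupp.single x 1 + Finsupp.single 0 t := by
        refine ⟨w 0 - Finsupp.single x (1 : S) 0, Finsupp.ext fun y => ?_⟩
        by_cases hy : y = 0
        · simp [hy]
        · simp [hw y hy, Finsupp.single_eq_of_ne hy]
      rw [ht] at h1 ⊢
      have : t = 0 := by simpa using h1
      simp [this]
    by_cases hx : x = 0
    · subst hx
      refine key _ (fun y hy => ?_) (haug 0)
      rw [heval]
      simp [algEval_apply, Finsupp.sum, Finsupp.single_eq_of_ne hy]
    · exact key _ (fun y hy => hval x y hx hy) (haug x)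

theorem isUnit_natCast_of_dvd {S : Type*} [CommRing S] {m n : ℕ} (h : m ∣ n)
    (hn : IsUnit (n : S)) : IsUnit (m : S) :=
  isUnit_of_dvd_unit (Nat.cast_dvd_cast h) hn

/-! ### Simple modules, via the density theorem. -/

section Simple

variable {R A : Type*} [Ring R] [AddCommGroup A] [Module R A] {k : ℕ}

theorem exists_smul_eq_of_end_linear [IsSemisimpleModule R A] [Finite A]
    (f : A →ₗ[Module.End R A] A) : ∃ r : R, ∀ a, f a = r • a := by
  obtain ⟨r, hr⟩ := Module.Finite.toModuleEnd_moduleEnd_surjective f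
  exact ⟨r, fun a => by rw [← hr]; rfl⟩

theorem factorsThrough_one_vecMulVec (b c : Fin k → R) :
    FactorsThrough 1 (Matrix.of fun i j => b i * c j) :=
  ⟨Matrix.of fun i _ => b i, Matrix.of fun _ j => c j, by ext i j; simp [Matrix.mul_apply]⟩

theorem matAct_vecMulVec (b c : Fin k → R) (x : Fin k → A) (i : Fin k) :
    matAct (Matrix.of fun i j => b i * c j) x i = b i • ∑ j, c j • x j := by
  simp [matAct_apply, mul_smul, Finset.smul_sum]

-- Fix `a ≠ 0`. Density provides `c j` with `∑ c j • x j = ξ x a`, and `b i` carrying `t a` to `t (v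
-- i)` for every endomorphism `t`. The matrix with entries `b i * c j` then works.
open Classical in
theorem exists_matAct_eq_smul [IsSimpleModule R A] [Finite A]
    (ξ : (Fin k → A) →ₗ[Module.End R A] Module.End R A) (v : Fin k → A) :
    ∃ r : Matrix (Fin k) (Fin k) R, FactorsThrough 1 r ∧ ∀ x, matAct r x = ξ x • v := by
  have : Nontrivial A := IsSimpleModule.nontrivial R A
  obtain ⟨a, ha⟩ := exists_ne (0 : A)
  have hb : ∀ w : A, ∃ b : R, ∀ t : Module.End R A, b • t a = t w := by
    intro w
    obtain ⟨f, hf⟩ := exists_functional_apply_eq_one (K := Module.End R A) ha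
    obtain ⟨b, hb⟩ := exists_smul_eq_of_end_linear (f.smulRight w)
    refine ⟨b, fun t => ?_⟩
    have h1 : f (t a) = t := by
      have := map_smul f t a
      rw [hf] at this
      simpa using this
    rw [← hb, LinearMap.smulRight_apply, h1]
    rfl
  have hc : ∀ j, ∃ c : R, ∀ z : A, c • z = ξ (Pi.single j z) a := by
    intro j
    obtain ⟨c, hc⟩ := exists_smul_eq_of_end_linear
      ((ξ ∘ₗ LinearMap.single (Module.End R A) (fun _ : Fin k => A) j).smulRight a)
    exact ⟨c, fun z => by rw [← hc]; rfl⟩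
  choose b hb using hb
  choose c hc using hc
  refine ⟨_, factorsThrough_one_vecMulVec (fun i => b (v i)) c, fun x => funext fun i => ?_⟩
  rw [matAct_vecMulVec]
  have : ∑ j, c j • x j = ξ x a := by
    have hx : x = ∑ j, Pi.single j (x j) := (Finset.univ_sum_single x).symm
    conv_rhs => rw [hx, map_sum, LinearMap.sum_apply]
    exact Finset.sum_congr rfl fun j _ => hc j _
  rw [this, hb]
  rfl

open Classical in
theorem exists_fixes_of_isSimpleModule {S : Type*} [CommRing S] [IsSimpleModule R A] [Finite A]
    (hS : IsUnit (Nat.card A : S)) : ∃ e ∈ lowRank S R k 1, Fixes A e := by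
  have : Nontrivial A := IsSimpleModule.nontrivial R A
  obtain ⟨a, ha⟩ := exists_ne (0 : A)
  have : Finite (Module.End R A) := Finite.of_injective _ DFunLike.coe_injective
  -- Evaluation at `a` embeds the dual of `A^k` in a group whose order is a power of `|A|`, so the
  -- order of the dual is invertible in `S`.
  let φ : ((Fin k → A) →ₗ[Module.End R A] Module.End R A) →+ ((Fin k → A) → A) :=
    { toFun := fun ξ v => ξ v a
      map_zero' := rfl
      map_add' := fun _ _ => rfl }
  have hφ : Function.Injective φ := by
    intro ξ ξ' h
    refine LinearMap.ext fun v => ?_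
    exact smul_left_injective (Module.End R A) ha (congrFun h v)
  have hunit : IsUnit (Nat.card ((Fin k → A) →ₗ[Module.End R A] Module.End R A) : S) := by
    refine isUnit_natCast_of_dvd (AddSubgroup.card_dvd_of_injective φ hφ) ?_
    rw [Nat.card_fun, Nat.cast_pow]
    exact hS.pow _
  obtain ⟨e, he, hfix⟩ := exists_rankOne_interpolation hunit
  have hσ : ∀ r : (Fin k → A) →ₗ[Module.End R A] (Fin k → A), ∃ m : Matrix (Fin k) (Fin k) R,
      (∃ (ξ : (Fin k → A) →ₗ[Module.End R A] Module.End R A) (v : Fin k → A),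
        r = ξ.smulRight v) → FactorsThrough 1 m ∧ ∀ x, matAct m x = r x := by
    intro r
    by_cases h : ∃ (ξ : (Fin k → A) →ₗ[Module.End R A] Module.End R A) (v : Fin k → A),
        r = ξ.smulRight v
    · obtain ⟨ξ, v, rfl⟩ := h
      obtain ⟨m, hm, hmx⟩ := exists_matAct_eq_smul ξ v
      exact ⟨m, fun _ => ⟨hm, hmx⟩⟩
    · exact ⟨0, fun h' => (h h').elim⟩
  choose σ hσ using hσ
  let T : MonoidAlgebra S ((Fin k → A) →ₗ[Module.End R A] (Fin k → A)) →ₗ[S]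
    MonoidAlgebra S (Matrix (Fin k) (Fin k) R) := algEval fun r => MonoidAlgebra.single (σ r) 1
  have key : ∀ w ∈ Submodule.span S ((fun r => MonoidAlgebra.single r (1 : S)) ''
        {r : (Fin k → A) →ₗ[Module.End R A] (Fin k → A) |
          ∃ (ξ : (Fin k → A) →ₗ[Module.End R A] Module.End R A) (v : Fin k → A),
            r = ξ.smulRight v}), T w ∈ lowRank S R k 1 ∧
      ∀ x : Fin k → A, algEval (fun r => Finsupp.single (matAct r x) (1 : S)) (T w) =
        algEval (fun r => Finsupp.single (r x) (1 : S)) w := by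
    intro w hw
    induction hw using Submodule.span_induction with
    | mem w hw =>
      obtain ⟨r, hr, rfl⟩ := hw
      simp only [T, algEval_single, one_smul]
      refine ⟨single_mem_lowRank (hσ r hr).1 1, fun x => ?_⟩
      rw [(hσ r hr).2]
    | zero => simp
    | add w w' _ _ h h' =>
      refine ⟨by rw [map_add]; exact Submodule.add_mem _ h.1 h'.1, fun x => ?_⟩
      rw [map_add, map_add, map_add, h.2, h'.2]
    | smul s w _ h =>
      refine ⟨by rw [map_smul]; exact Submodule.smul_mem _ _ h.1, fun x => ?_⟩
      rw [map_smul, map_smul, map_smul, h.2]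
  exact ⟨T e, (key e he).1, fixes_of_forall fun x => ((key e he).2 x).trans (hfix x)⟩

end Simple

/-! ### Distributive modules. -/

section Distributive

variable {R A : Type*} [Ring R] [AddCommGroup A] [Module R A]

theorem IsDistributiveModule.submodule (h : IsDistributiveModule R A) (X : Submodule R A) :
    IsDistributiveModule R X := by
  intro Y Z W
  apply Submodule.map_injective_of_injective X.injective_subtype
  rw [Submodule.map_inf _ X.injective_subtype, Submodule.map_sup, Submodule.map_sup,
    Submodule.map_inf _ X.injective_subtype, Submodule.map_inf _ X.injective_subtype, h]

theorem IsDistributiveModule.quotient (h : IsDistributiveModule R A) (X : Submodule R A) :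
    IsDistributiveModule R (A ⧸ X) := by
  intro Y Z W
  have hsurj := X.mkQ_surjective
  apply Submodule.comap_injective_of_surjective hsurj
  have hsup : ∀ U V : Submodule R (A ⧸ X), (U ⊔ V).comap X.mkQ = U.comap X.mkQ ⊔ V.comap X.mkQ := by
    intro U V
    have := Submodule.comap_map_eq X.mkQ (U.comap X.mkQ ⊔ V.comap X.mkQ)
    rw [Submodule.map_sup, Submodule.map_comap_eq_of_surjective hsurj,
      Submodule.map_comap_eq_of_surjective hsurj] at this
    rw [this, sup_eq_left]
    exact le_trans (LinearMap.ker_le_comap _) le_sup_left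
  rw [Submodule.comap_inf, hsup, hsup, Submodule.comap_inf, Submodule.comap_inf, h]

/-- The graph `G` of `f` lies in `X ⊔ Y` and meets `Y` trivially, so distributivity forces `G ≤ X`.
Hence `f x` lies in `X ⊓ Y = ⊥`. -/
theorem IsDistributiveModule.linearMap_eq_zero (h : IsDistributiveModule R A) {X Y : Submodule R A}
    (hXY : Disjoint X Y) (f : X →ₗ[R] Y) : f = 0 := by
  let G : Submodule R A := LinearMap.range (X.subtype + Y.subtype ∘ₗ f)
  have hG : G ≤ X ⊔ Y := by
    rintro _ ⟨x, rfl⟩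
    exact Submodule.add_mem_sup x.2 (f x).2
  have h0 : ∀ z ∈ G ⊓ Y, z = 0 := by
    rintro _ ⟨⟨x, rfl⟩, hz⟩
    have hx : (x : A) ∈ Y := by
      have := Y.sub_mem hz (f x).2
      simpa using this
    have : x = 0 := Subtype.ext (Submodule.disjoint_def.1 hXY _ x.2 hx)
    simp [this]
  ext x
  have hx : (x : A) + f x ∈ G ⊓ X ⊔ G ⊓ Y := by
    rw [← h G X Y]
    exact ⟨⟨x, rfl⟩, hG ⟨x, rfl⟩⟩
  obtain ⟨u, hu, v, hv, huv⟩ := Submodule.mem_sup.1 hx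
  rw [h0 v hv, add_zero] at huv
  have : ((f x : Y) : A) ∈ X := by
    have := X.sub_mem hu.2 x.2
    rw [huv] at this
    simpa using this
  simpa using Submodule.disjoint_def.1 hXY _ this (f x).2

end Distributive

/-! ### Semisimple distributive modules. -/

section Semisimple

variable {R A : Type*} [Ring R] [AddCommGroup A] [Module R A] {k : ℕ}

theorem FactorsThrough.exists_vecMulVec {r : Matrix (Fin k) (Fin k) R} (h : FactorsThrough 1 r) :
    ∃ b c : Fin k → R, r = Matrix.of fun i j => b i * c j := by
  obtain ⟨b, c, rfl⟩ := h
  exact ⟨fun i => b i 0, fun j => c 0 j, by ext i j; simp [Matrix.mul_apply]⟩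

/-- Every endomorphism preserves both summands, so the projection commutes with all of `End_R A` and
density makes it a scalar. -/
theorem IsDistributiveModule.exists_smul_eq_projection [IsSemisimpleModule R A] [Finite A]
    (h : IsDistributiveModule R A) {X Y : Submodule R A} (hXY : IsCompl X Y) :
    ∃ ε : R, (∀ x ∈ X, ε • x = x) ∧ ∀ y ∈ Y, ε • y = 0 := by
  let p : A →ₗ[R] X := X.projectionOnto Y hXY
  let q : A →ₗ[R] Y := Y.projectionOnto X hXY.symm
  have hpX : ∀ x : X, p x = x := Submodule.projectionOnto_apply_left hXY
  have hpY : ∀ y : Y, p y = 0 := Submodule.projectionOnto_apply_right hXY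
  have hdec : ∀ a, ∃ (x : X) (y : Y), a = (x : A) + (y : A) := by
    intro a
    obtain ⟨x, hx, y, hy, rfl⟩ := Submodule.mem_sup.1 (hXY.sup_eq_top ▸ Submodule.mem_top :
      a ∈ X ⊔ Y)
    exact ⟨⟨x, hx⟩, ⟨y, hy⟩, rfl⟩
  have hX : ∀ (t : Module.End R A) (x : X), t x ∈ X := by
    intro t x
    have h0 := LinearMap.congr_fun (h.linearMap_eq_zero hXY.disjoint (q ∘ₗ t ∘ₗ X.subtype)) x
    have h0 : q (t x) = 0 := h0
    rwa [Submodule.projectionOnto_apply_eq_zero_iff] at h0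
  have hY : ∀ (t : Module.End R A) (y : Y), t y ∈ Y := by
    intro t y
    have h0 := LinearMap.congr_fun (h.linearMap_eq_zero hXY.disjoint.symm (p ∘ₗ t ∘ₗ Y.subtype)) y
    have h0 : p (t y) = 0 := h0
    rwa [Submodule.projectionOnto_apply_eq_zero_iff] at h0
  let f : A →ₗ[Module.End R A] A :=
    { toFun := fun a => p a
      map_add' := by simp
      map_smul' := fun t a => by
        obtain ⟨x, y, rfl⟩ := hdec a
        have h1 := hpX ⟨t x, hX t x⟩
        have h2 := hpY ⟨t y, hY t y⟩
        simp only at h1 h2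
        simp [hpX, hpY, h1, h2] }
  obtain ⟨ε, hε⟩ := exists_smul_eq_of_end_linear f
  refine ⟨ε, fun x hx => ?_, fun y hy => ?_⟩
  · rw [← hε]
    exact congrArg Subtype.val (hpX ⟨x, hx⟩)
  · rw [← hε]
    exact congrArg Subtype.val (hpY ⟨y, hy⟩)

theorem exists_fixes_of_isCompl {S : Type*} [CommRing S] [IsSemisimpleModule R A] [Finite A]
    (h : IsDistributiveModule R A) {X Y : Submodule R A} (hXY : IsCompl X Y)
    (hX : ∃ e ∈ lowRank S R k 1, Fixes X e) (hY : ∃ e ∈ lowRank S R k 1, Fixes Y e) :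
    ∃ e ∈ lowRank S R k 1, Fixes A e := by
  obtain ⟨e, he, hfe⟩ := hX
  obtain ⟨e', he', hfe'⟩ := hY
  obtain ⟨ε, hεX, hεY⟩ := h.exists_smul_eq_projection hXY
  have hbc : ∀ r : Matrix (Fin k) (Fin k) R, ∃ b c : Fin k → R,
      FactorsThrough 1 r → r = Matrix.of fun i j => b i * c j := fun r => by
    by_cases hr : FactorsThrough 1 r
    · obtain ⟨b, c, h⟩ := hr.exists_vecMulVec
      exact ⟨b, c, fun _ => h⟩
    · exact ⟨0, 0, fun h => (hr h).elim⟩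
  choose b c hbc using hbc
  -- Since `ε` acts as `1` on `X` and `0` on `Y`, this single column-times-row product acts as `r`
  -- on `X^k` and as `r'` on `Y^k`.
  let F : Matrix (Fin k) (Fin k) R → Matrix (Fin k) (Fin k) R → Matrix (Fin k) (Fin k) R :=
    fun r r' => Matrix.of fun i j =>
      (b r i * ε + b r' i * (1 - ε)) * (ε * c r j + (1 - ε) * c r' j)
  have hF : ∀ r r', FactorsThrough 1 r → FactorsThrough 1 r' → ∀ (x : Fin k → X) (y : Fin k → Y),
      matAct (F r r') (X.subtype ∘ x + Y.subtype ∘ y) =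
        X.subtype ∘ matAct r x + Y.subtype ∘ matAct r' y := by
    intro r r' hr hr' x y
    rw [← matAct_comp, ← matAct_comp]
    conv_rhs => rw [hbc r hr, hbc r' hr']
    ext i
    simp only [F, Pi.add_apply, matAct_vecMulVec]
    have hx : ∀ d : Fin k → R, ∑ j, d j • (X.subtype ∘ x) j ∈ X :=
      fun d => X.sum_mem fun j _ => X.smul_mem _ (x j).2
    have hy : ∀ d : Fin k → R, ∑ j, d j • (Y.subtype ∘ y) j ∈ Y :=
      fun d => Y.sum_mem fun j _ => Y.smul_mem _ (y j).2
    have hsum : ∀ d : Fin k → R, ∑ j, d j • ((X.subtype ∘ x) j + (Y.subtype ∘ y) j) =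
        ∑ j, d j • (X.subtype ∘ x) j + ∑ j, d j • (Y.subtype ∘ y) j := by
      intro d
      simp only [smul_add, Finset.sum_add_distrib]
    have h1 : ∑ j, (ε * c r j + (1 - ε) * c r' j) •
          ((X.subtype ∘ x) j + (Y.subtype ∘ y) j) =
        ∑ j, c r j • (X.subtype ∘ x) j + ∑ j, c r' j • (Y.subtype ∘ y) j := by
      simp only [add_smul, mul_smul, Finset.sum_add_distrib, ← Finset.smul_sum]
      rw [hsum, hsum, smul_add, smul_add, hεX _ (hx _), hεY _ (hy _), sub_smul, sub_smul, one_smul,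
        one_smul, hεX _ (hx _), hεY _ (hy _)]
      abel
    rw [h1, add_smul, mul_smul, mul_smul, smul_add, hεX _ (hx _), hεY _ (hy _), sub_smul, one_smul,
      smul_add ε, hεX _ (hx _), hεY _ (hy _)]
    simp
  refine ⟨algComb F e e', algComb_mem_lowRank he he' fun r r' _ _ =>
    factorsThrough_one_vecMulVec _ _, fixes_of_forall fun a => ?_⟩
  obtain ⟨x, y, rfl⟩ : ∃ (x : Fin k → X) (y : Fin k → Y), a = X.subtype ∘ x + Y.subtype ∘ y := by
    have hdec : ∀ i, ∃ (x : X) (y : Y), a i = (x : A) + (y : A) := by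
      intro i
      obtain ⟨x, hx, y, hy, hxy⟩ := Submodule.mem_sup.1 (hXY.sup_eq_top ▸ Submodule.mem_top :
        a i ∈ X ⊔ Y)
      exact ⟨⟨x, hx⟩, ⟨y, hy⟩, hxy.symm⟩
    choose x y hxy using hdec
    exact ⟨x, y, funext hxy⟩
  rw [algEval_algComb]
  have step : ∀ r ∈ e.coeff.support,
      algEval (fun r' => Finsupp.single
        (matAct (F r r') (X.subtype ∘ x + Y.subtype ∘ y)) (1 : S)) e' =
      Finsupp.single (X.subtype ∘ matAct r x + Y.subtype ∘ y) 1 := by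
    intro r hr
    rw [← hfe'.algEval y fun w => Finsupp.single (X.subtype ∘ matAct r x + Y.subtype ∘ w) (1 : S)]
    exact algEval_congr fun r' hr' => by rw [hF r r' (he r hr) (he' r' hr')]
  rw [← hfe.algEval x fun w => Finsupp.single (X.subtype ∘ w + Y.subtype ∘ y) (1 : S)]
  exact algEval_congr step

end Semisimple

theorem exists_fixes_of_isSemisimpleModule {S R : Type*} [CommRing S] [Ring R] (k : ℕ)
    {A : Type*} [AddCommGroup A] [Module R A] [IsSemisimpleModule R A] [Finite A]
    (h : IsDistributiveModule R A) (hS : IsUnit (Nat.card A : S)) :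
    ∃ e ∈ lowRank S R k 1, Fixes A e := by
  induction hn : Nat.card A using Nat.strong_induction_on generalizing A with
  | _ n ih =>
    subst hn
    rcases subsingleton_or_nontrivial A with hA | hA
    · exact ⟨_, single_mem_lowRank (.zero 1) 1, fixes_single_zero⟩
    by_cases hs : IsSimpleModule R A
    · exact exists_fixes_of_isSimpleModule hS
    obtain ⟨X, hX0, hX1⟩ : ∃ X : Submodule R A, X ≠ ⊥ ∧ X ≠ ⊤ := by
      by_contra! H
      exact hs ((isSimpleModule_iff R A).2 ⟨fun X => or_iff_not_imp_left.2 (H X)⟩)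
    obtain ⟨Y, hXY⟩ := exists_isCompl X
    have hY1 : Y ≠ ⊤ := by
      rintro rfl
      exact hX0 (by simpa using hXY.inf_eq_bot)
    have key : ∀ Z : Submodule R A, Z ≠ ⊤ → ∃ e ∈ lowRank S R k 1, Fixes Z e := by
      intro Z hZ
      refine ih _ ?_ (h.submodule Z)
        (isUnit_natCast_of_dvd (AddSubgroup.card_addSubgroup_dvd_card Z.toAddSubgroup) hS) rfl
      exact Set.ncard_lt_card (s := (Z : Set A)) (by simpa using hZ)
    exact exists_fixes_of_isCompl h hXY (key X hX1) (key Y hY1)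

/-! ### Averaging over the Jacobson radical. -/

section Average

/-- Evaluate the double sum of `g (x + φ h + ψ h')` in both orders: each inner sum is independent of
the outer variable. Then cancel `|H|`. -/
theorem sum_translate_range_eq {S H W N : Type*} [CommRing S] [AddCommGroup H] [Fintype H]
    [AddCommGroup W] [AddCommGroup N] [Module S N] (hS : IsUnit (Fintype.card H : S))
    (φ ψ : H →+ W) (hφψ : φ.range = ψ.range) {x y : W} (hxy : y - x ∈ φ.range) (g : W → N) :
    ∑ h, g (x + φ h) = ∑ h, g (y + ψ h) := by
  have h1 : ∀ h, ∑ h', g (x + φ h + ψ h') = ∑ h', g (y + ψ h') := by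
    intro h
    obtain ⟨u, hu⟩ : x + φ h - y ∈ ψ.range := by
      rw [← hφψ]
      have := φ.range.sub_mem ⟨h, rfl⟩ hxy
      convert! this using 1
      abel
    refine Fintype.sum_equiv (Equiv.addRight u) _ _ fun h' => ?_
    rw [Equiv.coe_addRight, map_add, hu]
    congr 1
    abel
  have h2 : ∀ h', ∑ h, g (x + φ h + ψ h') = ∑ h, g (x + φ h) := by
    intro h'
    obtain ⟨u, hu⟩ : ψ h' ∈ φ.range := by
      rw [hφψ]
      exact ⟨h', rfl⟩
    refine Fintype.sum_equiv (Equiv.addRight u) _ _ fun h => ?_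
    rw [Equiv.coe_addRight, map_add, hu]
    congr 1
    abel
  have h3 := Finset.sum_comm (s := Finset.univ) (t := Finset.univ)
    (f := fun h h' => g (x + φ h + ψ h'))
  simp only [h1, h2, Finset.sum_const, Finset.card_univ] at h3
  rw [← Nat.cast_smul_eq_nsmul S, ← Nat.cast_smul_eq_nsmul S] at h3
  exact (hS.smul_left_cancel.1 h3).symm

variable {R A : Type*} [Ring R] [AddCommGroup A] [Module R A] {k : ℕ}

theorem mem_ideal_smul_span_range_iff (J : Ideal R) [J.IsTwoSided] (x : Fin k → A) (a : A) :
    a ∈ J • Submodule.span R (Set.range x) ↔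
      ∃ c : Fin k → R, (∀ j, c j ∈ J) ∧ a = ∑ j, c j • x j := by
  constructor
  · intro ha
    refine Submodule.smul_induction_on ha (fun r hr n hn => ?_) ?_
    · obtain ⟨c, rfl⟩ := (Submodule.mem_span_range_iff_exists_fun R).1 hn
      exact ⟨fun j => r * c j, fun j => J.mul_mem_right _ hr, by
        simp [Finset.smul_sum, mul_smul]⟩
    · rintro _ _ ⟨c, hc, rfl⟩ ⟨d, hd, rfl⟩
      exact ⟨c + d, fun j => J.add_mem (hc j) (hd j), by
        simp [add_smul, Finset.sum_add_distrib]⟩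
  · rintro ⟨c, hc, rfl⟩
    exact Submodule.sum_mem _ fun j _ =>
      Submodule.smul_mem_smul (hc j) (Submodule.subset_span ⟨j, rfl⟩)

/-- Nakayama's lemma, applied to the image of `X` in `A ⧸ Y`. -/
theorem span_range_eq_of_sub_mem [Finite A] {x y : Fin k → A}
    (h : ∀ i, y i - x i ∈ Ring.jacobson R • Submodule.span R (Set.range x)) :
    Submodule.span R (Set.range y) = Submodule.span R (Set.range x) := by
  set X := Submodule.span R (Set.range x)
  set Y := Submodule.span R (Set.range y)
  have hJX : Ring.jacobson R • X ≤ X := Submodule.smul_le_right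
  have hx : ∀ i, x i ∈ X := fun i => Submodule.subset_span ⟨i, rfl⟩
  have hy : ∀ i, y i ∈ Y := fun i => Submodule.subset_span ⟨i, rfl⟩
  apply le_antisymm
  · refine Submodule.span_le.2 ?_
    rintro _ ⟨i, rfl⟩
    simpa using X.add_mem (hJX (h i)) (hx i)
  · have hfg : (X.map Y.mkQ).FG := (Submodule.FG.map _ (Submodule.fg_span (Set.finite_range x)))
    have h0 : X.map Y.mkQ = ⊥ := by
      refine hfg.eq_bot_of_le_jacobson_smul ?_
      rw [← Submodule.map_smul'']
      refine Submodule.map_le_iff_le_comap.2 (Submodule.span_le.2 ?_)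
      rintro _ ⟨i, rfl⟩
      refine ⟨x i - y i, ?_, ?_⟩
      · rw [← neg_sub]
        exact Submodule.neg_mem _ (h i)
      · rw [map_sub, sub_eq_self]
        simpa using hy i
    intro a ha
    have : Y.mkQ a ∈ X.map Y.mkQ := ⟨a, ha, rfl⟩
    rw [h0] at this
    simpa using this

theorem exists_jacobson_average {S : Type*} [CommRing S] [Finite A]
    (hS : IsUnit (Nat.card A : S)) :
    ∃ e : MonoidAlgebra S (Matrix (Fin k) (Fin k) R),
      (∀ (x : Fin k → A) (g : (Fin k → A) → (Fin k → A) →₀ S) (w : (Fin k → A) →₀ S),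
        (∀ y, (∀ i, y i - x i ∈ Ring.jacobson R • Submodule.span R (Set.range x)) → g y = w) →
        algEval (fun r => g (matAct r x)) e = w) ∧
      ∀ x y : Fin k → A,
        (∀ i, y i - x i ∈ Ring.jacobson R • Submodule.span R (Set.range x)) →
        fnAct S A e (Finsupp.single y 1) = fnAct S A e (Finsupp.single x 1) := by
  classical
  -- As `R` may be infinite, the average runs over the finite group of maps induced by matrices over
  -- the radical, with one chosen matrix `σ h` for each map. The order of this group divides a power
  -- of `|A|`.
  let Ψ : (Fin k → Fin k → Ring.jacobson R) →+ ((Fin k → A) → (Fin k → A)) :=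
    { toFun := fun M x => matAct (Matrix.of fun i j => (M i j : R)) x
      map_zero' := by ext; simp [matAct_apply]
      map_add' := fun M M' => by
        ext
        simp [matAct_apply, add_smul, Finset.sum_add_distrib] }
  have : Fintype Ψ.range := Fintype.ofFinite _
  choose σ hσ using fun h : Ψ.range => h.2
  have hcard : IsUnit (Fintype.card Ψ.range : S) := by
    rw [← Nat.card_eq_fintype_card]
    refine isUnit_natCast_of_dvd (AddSubgroup.card_addSubgroup_dvd_card Ψ.range) ?_
    rw [Nat.card_fun, Nat.card_fun, Nat.cast_pow, Nat.cast_pow]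
    exact (hS.pow _).pow _
  obtain ⟨u, hu⟩ := hcard.exists_left_inv
  let ev : (Fin k → A) → Ψ.range →+ (Fin k → A) := fun x =>
    { toFun := fun h => h.1 x
      map_zero' := rfl
      map_add' := fun _ _ => rfl }
  have hrange : ∀ x z, z ∈ (ev x).range ↔
      ∀ i, z i ∈ Ring.jacobson R • Submodule.span R (Set.range x) := by
    intro x z
    constructor
    · rintro ⟨⟨_, M, rfl⟩, rfl⟩ i
      exact (mem_ideal_smul_span_range_iff _ x _).2 ⟨fun j => M i j, fun j => (M i j).2, rfl⟩
    · intro hz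
      choose c hc hzc using fun i => (mem_ideal_smul_span_range_iff _ x _).1 (hz i)
      exact ⟨⟨_, fun i j => ⟨c i j, hc i j⟩, rfl⟩, funext fun i => (hzc i).symm⟩
  let e : MonoidAlgebra S (Matrix (Fin k) (Fin k) R) :=
    u • ∑ h, MonoidAlgebra.single (1 + Matrix.of fun i j => (σ h i j : R)) (1 : S)
  have hact : ∀ (h : Ψ.range) (x : Fin k → A),
      matAct (1 + Matrix.of fun i j => (σ h i j : R)) x = x + ev x h := by
    intro h x
    rw [matAct_add_left, matAct_one]
    exact congrArg (x + ·) (congrFun (hσ h) x)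
  have heval : ∀ (x : Fin k → A) (g : (Fin k → A) → (Fin k → A) →₀ S),
      algEval (fun r => g (matAct r x)) e = u • ∑ h, g (x + ev x h) := by
    intro x g
    simp [e, hact]
  refine ⟨e, fun x g w hg => ?_, fun x y hxy => ?_⟩
  · rw [heval, Finset.sum_congr rfl fun h _ => hg (x + ev x h) fun i => ?_]
    · rw [Finset.sum_const, Finset.card_univ, ← Nat.cast_smul_eq_nsmul S, smul_smul, hu, one_smul]
    · rw [Pi.add_apply, add_sub_cancel_left]
      exact (hrange x _).1 ⟨h, rfl⟩ i
  · rw [fnAct_single, fnAct_single, heval y fun z => Finsupp.single z 1,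
      heval x fun z => Finsupp.single z 1]
    congr 1
    have hspan := span_range_eq_of_sub_mem hxy
    refine (sum_translate_range_eq hcard (ev x) (ev y) ?_ ((hrange x _).2 hxy)
      fun z => Finsupp.single z (1 : S)).symm
    ext z
    rw [hrange, hrange, hspan]

end Average

/-! ### From the radical average to a rank-one combination. -/

section Main

variable {S R A : Type*} [CommRing S] [Ring R] [AddCommGroup A] [Module R A] {k : ℕ}

theorem isSemisimpleModule_quotient_jacobson_smul
    (hR : IsSemisimpleRing (R ⧸ Ring.jacobson R)) :
    IsSemisimpleModule R (A ⧸ (Ring.jacobson R • ⊤ : Submodule R A)) := by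
  have h : Module.IsTorsionBySet R (A ⧸ (Ring.jacobson R • ⊤ : Submodule R A))
      (Ring.jacobson R) := by
    rw [Module.isTorsionBySet_quotient_iff]
    exact fun x r hr => Submodule.smul_mem_smul hr Submodule.mem_top
  let _ := h.module
  exact h.isSemisimpleModule_iff.1 inferInstance

/-- By Nakayama, having span `X` depends only on residues modulo `JX`. Thus `g`, restricted to
`X^k`, factors through `(X/JX)^k`, where `e` acts as the identity. -/
theorem algEval_ite_span_eq [Finite A] {N : Type*} [AddCommGroup N] [Module S N]
    {e : MonoidAlgebra S (Matrix (Fin k) (Fin k) R)} (x : Fin k → A) (G : (Fin k → A) → N)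
    (he : Fixes (Submodule.span R (Set.range x) ⧸
      (Ring.jacobson R • ⊤ : Submodule R (Submodule.span R (Set.range x)))) e)
    (hG : ∀ y z : Fin k → A,
      (∀ i, z i - y i ∈ Ring.jacobson R • Submodule.span R (Set.range y)) → G z = G y)
    (g : (Fin k → A) → N)
    (hg : ∀ y, Submodule.span R (Set.range y) = Submodule.span R (Set.range x) → g y = G y)
    (hg0 : ∀ y, Submodule.span R (Set.range y) ≠ Submodule.span R (Set.range x) → g y = 0) :
    algEval (fun r => g (matAct r x)) e = G x := by
  set X := Submodule.span R (Set.range x) with hX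
  let Q : Submodule R X := Ring.jacobson R • ⊤
  have hQ : ∀ u : X, u ∈ Q → (u : A) ∈ Ring.jacobson R • X := by
    intro u hu
    have : X.subtype u ∈ Q.map X.subtype := ⟨u, hu, rfl⟩
    rwa [Submodule.map_smul'', Submodule.map_top, Submodule.range_subtype] at this
  have hcongr : ∀ y z : Fin k → X, Q.mkQ ∘ y = Q.mkQ ∘ z →
      g (X.subtype ∘ y) = g (X.subtype ∘ z) := by
    intro y z hyz
    have hsub : ∀ i, (z i : A) - y i ∈ Ring.jacobson R • X := fun i =>
      hQ (z i - y i) ((Submodule.Quotient.eq Q).1 (congrFun hyz i).symm)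
    have hsub' : ∀ i, (y i : A) - z i ∈ Ring.jacobson R • X := fun i =>
      hQ (y i - z i) ((Submodule.Quotient.eq Q).1 (congrFun hyz i))
    by_cases hy : Submodule.span R (Set.range (X.subtype ∘ y)) = X
    · have h1 : ∀ i, (X.subtype ∘ z) i - (X.subtype ∘ y) i ∈
          Ring.jacobson R • Submodule.span R (Set.range (X.subtype ∘ y)) := by
        rw [hy]
        exact hsub
      rw [hg _ hy, hg _ ((span_range_eq_of_sub_mem h1).trans hy), hG _ _ h1]
    · by_cases hz : Submodule.span R (Set.range (X.subtype ∘ z)) = X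
      · have h1 : ∀ i, (X.subtype ∘ y) i - (X.subtype ∘ z) i ∈
            Ring.jacobson R • Submodule.span R (Set.range (X.subtype ∘ z)) := by
          rw [hz]
          exact hsub'
        exact (hy ((span_range_eq_of_sub_mem h1).trans hz)).elim
      · rw [hg0 _ hy, hg0 _ hz]
  let x' : Fin k → X := fun i => ⟨x i, Submodule.subset_span ⟨i, rfl⟩⟩
  let g' : (Fin k → X ⧸ Q) → N := fun w =>
    g (X.subtype ∘ fun i => Function.surjInv Q.mkQ_surjective (w i))
  have hg' : ∀ y : Fin k → X, g' (Q.mkQ ∘ y) = g (X.subtype ∘ y) := by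
    intro y
    refine hcongr _ _ (funext fun i => ?_)
    exact Function.surjInv_eq Q.mkQ_surjective _
  have key := he.algEval (Q.mkQ ∘ x') g'
  rw [hg', show X.subtype ∘ x' = x from rfl, hg x rfl] at key
  rw [← key]
  refine algEval_congr fun r _ => ?_
  rw [matAct_comp, hg', ← matAct_comp]
  rfl

theorem exists_lowRank_fnAct_eq [Finite A] (hR : IsSemisimpleRing (R ⧸ Ring.jacobson R))
    (hA : IsDistributiveModule R A) (hS : IsUnit (Nat.card A : S))
    {a : MonoidAlgebra S (Matrix (Fin k) (Fin k) R)}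
    (ha : ∀ (x : Fin k → A) (g : (Fin k → A) → (Fin k → A) →₀ S) (w : (Fin k → A) →₀ S),
        (∀ y, (∀ i, y i - x i ∈ Ring.jacobson R • Submodule.span R (Set.range x)) → g y = w) →
        algEval (fun r => g (matAct r x)) a = w)
    (ha' : ∀ x y : Fin k → A,
        (∀ i, y i - x i ∈ Ring.jacobson R • Submodule.span R (Set.range x)) →
        fnAct S A a (Finsupp.single y 1) = fnAct S A a (Finsupp.single x 1)) :
    ∃ e ∈ lowRank S R k 1, fnAct S A e = fnAct S A a := by
  classical
  have : Finite (Submodule R A) := Finite.of_injective _ SetLike.coe_injective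
  obtain ⟨e, he, hfix⟩ := exists_uniform_fixes (S := S) (R := R) (k := k) (p := 1)
    (fun X : Submodule R A => X ⧸ (Ring.jacobson R • ⊤ : Submodule R X)) fun X => by
      have := isSemisimpleModule_quotient_jacobson_smul (A := X) hR
      have : Finite (X ⧸ (Ring.jacobson R • ⊤ : Submodule R X)) :=
        Finite.of_surjective _ (Submodule.mkQ_surjective _)
      refine exists_fixes_of_isSemisimpleModule k ((hA.submodule X).quotient _)
        (isUnit_natCast_of_dvd ?_ hS)
      exact (AddSubgroup.card_quotient_dvd_card
        (Ring.jacobson R • ⊤ : Submodule R X).toAddSubgroup).trans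
        (AddSubgroup.card_addSubgroup_dvd_card X.toAddSubgroup)
  have hmem : ∀ x : Fin k → A, fnAct S A a (Finsupp.single x 1) ∈
      Submodule.span S ((fun y => Finsupp.single y (1 : S)) ''
        {y : Fin k → A | Submodule.span R (Set.range y) = Submodule.span R (Set.range x)}) := by
    intro x
    -- This function vanishes on `x + (JX)^k`, so `a` evaluates it to `0`; subtracting it discards
    -- every term of a different span.
    let g : (Fin k → A) → (Fin k → A) →₀ S := fun y =>
      if Submodule.span R (Set.range y) = Submodule.span R (Set.range x) then 0
      else Finsupp.single y 1
    have h0 := ha x g 0 fun y hy => if_pos (span_range_eq_of_sub_mem hy)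
    rw [fnAct_single, ← sub_zero (algEval _ a), ← h0, ← algEval_sub_fun]
    refine algEval_mem _ _ fun r _ => ?_
    by_cases h : Submodule.span R (Set.range (matAct r x)) = Submodule.span R (Set.range x)
    · simp only [g, if_pos h, sub_zero]
      exact Submodule.subset_span (Set.mem_image_of_mem _ h)
    · simp [g, if_neg h]
  have hstep : ∀ x : Fin k → A, fnAct S A (a - a * e) (Finsupp.single x 1) ∈
      Submodule.span S ((fun y => Finsupp.single y (1 : S)) ''
        {y : Fin k → A | Submodule.span R (Set.range y) < Submodule.span R (Set.range x)}) := by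
    intro x
    let G : (Fin k → A) → (Fin k → A) →₀ S := fun y => fnAct S A a (Finsupp.single y 1)
    let g : (Fin k → A) → (Fin k → A) →₀ S := fun y =>
      if Submodule.span R (Set.range y) = Submodule.span R (Set.range x) then G y else 0
    have h1 : algEval (fun r => g (matAct r x)) e = G x :=
      algEval_ite_span_eq x G (hfix _) ha' g (fun y hy => if_pos hy) fun y hy => if_neg hy
    have h2 : fnAct S A (a - a * e) (Finsupp.single x 1) =
        algEval (fun r => g (matAct r x) - G (matAct r x)) e := by
      rw [algEval_sub_fun, h1, ← fnAct_mul_single, map_sub]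
      rfl
    rw [h2]
    refine algEval_mem _ _ fun r _ => ?_
    by_cases h : Submodule.span R (Set.range (matAct r x)) = Submodule.span R (Set.range x)
    · simp [g, if_pos h]
    · simp only [g, if_neg h, zero_sub]
      refine Submodule.neg_mem _ (Submodule.span_mono ?_ (hmem (matAct r x)))
      refine Set.image_mono fun y (hy : Submodule.span R (Set.range y) = _) => ?_
      have hle : Submodule.span R (Set.range (matAct r x)) ≤ Submodule.span R (Set.range x) := by
        refine Submodule.span_le.2 ?_
        rintro _ ⟨i, rfl⟩
        exact matAct_mem _ r (fun i => Submodule.subset_span (Set.mem_range_self i)) i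
      exact (le_of_eq hy).trans_lt (lt_of_le_of_ne hle h)
  -- Each factor strictly shrinks the span, and no span has cardinality `0`, so `|A|` factors
  -- suffice.
  have hnil : ∀ n (x : Fin k → A), Nat.card (Submodule.span R (Set.range x)) ≤ n →
      fnAct S A ((a - a * e) ^ n) (Finsupp.single x 1) = 0 := by
    intro n
    induction n with
    | zero => exact fun x hx => absurd hx (not_le.2 Nat.card_pos)
    | succ n ih =>
      intro x hx
      rw [pow_succ, map_mul, Module.End.mul_apply]
      have hle : Submodule.span S ((fun y => Finsupp.single y (1 : S)) ''
          {y : Fin k → A | Submodule.span R (Set.range y) < Submodule.span R (Set.range x)}) ≤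
          LinearMap.ker (fnAct S A ((a - a * e) ^ n)) := by
        refine Submodule.span_le.2 ?_
        rintro _ ⟨y, hy, rfl⟩
        refine ih y (Nat.le_of_lt_succ (lt_of_lt_of_le ?_ hx))
        exact Set.ncard_lt_ncard (SetLike.coe_ssubset_coe.2 hy) (Set.toFinite _)
      exact hle (hstep x)
  have hidem : fnAct S A (a * a) = fnAct S A a := by
    refine Finsupp.lhom_ext' fun x => LinearMap.ext_ring ?_
    simp only [LinearMap.comp_apply, Finsupp.lsingle_apply]
    rw [fnAct_mul_single]
    exact ha x (fun y => fnAct S A a (Finsupp.single y 1)) _ (ha' x)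
  -- Modulo the ideal of rank-one combinations, `a - ae` is just `a`.
  have hpow : ∀ n, ∃ d ∈ lowRank S R k 1, (a - a * e) ^ n = a ^ n - d := by
    intro n
    induction n with
    | zero => exact ⟨0, Submodule.zero_mem _, by simp⟩
    | succ n ih =>
      obtain ⟨d, hd, h⟩ := ih
      refine ⟨a ^ n * (a * e) + d * (a - a * e), Submodule.add_mem _
        (mul_mem_lowRank_right _ (mul_mem_lowRank_right _ he)) (mul_mem_lowRank_left hd _), ?_⟩
      rw [pow_succ, h, pow_succ]
      noncomm_ring
  obtain ⟨d, hd, hda⟩ := hpow (Nat.card A)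
  have hzero : fnAct S A ((a - a * e) ^ Nat.card A) = 0 := by
    refine Finsupp.lhom_ext' fun x => LinearMap.ext_ring ?_
    exact hnil _ x (Set.ncard_le_card _)
  obtain ⟨m, hm⟩ := Nat.exists_eq_succ_of_ne_zero (Nat.card_pos (α := A)).ne'
  have hsq : IsIdempotentElem (fnAct S A a) := by
    rw [map_mul] at hidem
    exact hidem
  refine ⟨d, hd, ?_⟩
  have hd' : a ^ Nat.card A = d + (a - a * e) ^ Nat.card A := by
    rw [hda, add_sub_cancel]
  have h1 : fnAct S A (a ^ Nat.card A) = fnAct S A d := by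
    rw [hd', map_add, hzero, add_zero]
  rw [← h1, map_pow, hm, hsq.pow_succ_eq]

theorem exists_lowRank_local [Finite A] (hR : IsSemisimpleRing (R ⧸ Ring.jacobson R))
    (hA : IsDistributiveModule R A) (hS : IsUnit (Nat.card A : S)) :
    ∃ e ∈ lowRank S R k 1, ∀ (x : Fin k → A) (g : (Fin k → A) → (Fin k → A) →₀ S)
      (w : (Fin k → A) →₀ S),
      (∀ y, (∀ i, y i - x i ∈ (Ring.jacobson R • ⊤ : Submodule R A)) → g y = w) →
      algEval (fun r => g (matAct r x)) e = w := by
  obtain ⟨a, ha, ha'⟩ := exists_jacobson_average (R := R) (k := k) hS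
  obtain ⟨e, he, hea⟩ := exists_lowRank_fnAct_eq hR hA hS ha ha'
  refine ⟨e, he, fun x g w h => ?_⟩
  rw [← fnAct_eq_algEval, hea, fnAct_eq_algEval]
  exact ha x g w fun y hy => h y fun i => Submodule.smul_mono le_rfl le_top (hy i)

end Main

/-! ### Induction on the radical length, and descent to the centre of `S`. -/

theorem exists_fixes_of_jacobson_pow_smul_eq_bot {S R : Type*} [CommRing S] [Ring R]
    (hR : IsSemisimpleRing (R ⧸ Ring.jacobson R)) (k n : ℕ) {A : Type*} [AddCommGroup A]
    [Module R A] [Finite A] (hA : IsDistributiveModule R A) (hS : IsUnit (Nat.card A : S))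
    (hn : (Ring.jacobson R ^ n • ⊤ : Submodule R A) = ⊥) :
    ∃ e ∈ lowRank S R k n, Fixes A e := by
  induction n generalizing A with
  | zero =>
    have : Subsingleton A := by
      rw [Submodule.pow_zero, Ideal.one_eq_top, Submodule.top_smul] at hn
      exact (Submodule.subsingleton_iff R).1 (subsingleton_of_bot_eq_top hn.symm)
    exact ⟨_, single_mem_lowRank (.zero 0) 1, fixes_single_zero⟩
  | succ n ih =>
    let Z : Submodule R A := Ring.jacobson R • ⊤
    have hZ : (Ring.jacobson R ^ n • ⊤ : Submodule R Z) = ⊥ := by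
      apply Submodule.map_injective_of_injective Z.injective_subtype
      rw [Submodule.map_smul'', Submodule.map_top, Submodule.range_subtype, Submodule.map_bot, ← hn,
        Submodule.pow_succ, Submodule.mul_smul]
    obtain ⟨e', he', hfix⟩ := ih (hA.submodule Z)
      (isUnit_natCast_of_dvd (AddSubgroup.card_addSubgroup_dvd_card Z.toAddSubgroup) hS) hZ
    obtain ⟨e, he, hloc⟩ := exists_lowRank_local (k := k) hR hA hS
    refine ⟨algComb (fun r u => r + u * (1 - r)) e e', algComb_mem_lowRank he he' fun r u hr hu => ?_,
      fixes_of_forall fun x => ?_⟩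
    · rw [add_comm n 1]
      exact hr.add (hu.mul_right _)
    rw [algEval_algComb]
    simp only [matAct_add_left, matAct_mul, matAct_sub_left, matAct_one]
    -- For `y` congruent to `x` modulo `JA`, the entries of `x - y` lie in `JA`, where `e'` acts as
    -- the identity. The inner combination is therefore `x` for every such `y`, and the local
    -- property of `e` applies.
    refine hloc x (fun y => algEval (fun u => Finsupp.single (y + matAct u (x - y)) (1 : S)) e') _
      fun y hy => ?_
    let z : Fin k → Z := fun i => ⟨x i - y i, by rw [← neg_sub]; exact Z.neg_mem (hy i)⟩
    have hz : x - y = Z.subtype ∘ z := rfl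
    have := hfix.algEval z fun w => Finsupp.single (y + Z.subtype ∘ w) (1 : S)
    rw [← hz, add_sub_cancel] at this
    rw [← this]
    refine algEval_congr fun u _ => ?_
    rw [hz, matAct_comp]

theorem mainTheorem2 {R S A B : Type*} [Ring R] [Ring S]
    [AddCommGroup A] [Module R A] [AddCommGroup B] [Module S B]
    (hR : IsSemisimpleRing (R ⧸ Ring.jacobson R))
    (n : ℕ) (hn : Ring.jacobson R ^ n = ⊥)
    (hfin : Finite A) (hdist : IsDistributiveModule R A)
    (hunit : IsUnit ((Nat.card A : ℕ) : S))
    (k : ℕ) :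
    ∃ s : {r : Matrix (Fin k) (Fin k) R // innerRank r ≤ n} →₀ S,
      ∀ (f : (Fin k → A) → B) (x : Fin k → A),
        f x = s.sum fun r c => c • f (matAct r.1 x) := by
  classical
  -- The integer `|A|` is central, hence so is its inverse; the commutative case then applies over
  -- the centre.
  have hC : IsUnit ((Nat.card A : ℕ) : Subring.center S) := by
    obtain ⟨u, hu⟩ := hunit
    have hc : (↑u⁻¹ : S) ∈ Subring.center S := by
      rw [Subring.mem_center_iff]
      intro g
      have : Commute g (u : S) := by
        rw [hu]
        exact Nat.commute_cast g _
      exact this.units_inv_right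
    refine IsUnit.of_mul_eq_one ⟨_, hc⟩ (Subtype.ext ?_)
    simp [← hu]
  obtain ⟨e, he, hfix⟩ := exists_fixes_of_jacobson_pow_smul_eq_bot hR k n hdist hC
    (by rw [hn, Submodule.bot_smul])
  let s : {r : Matrix (Fin k) (Fin k) R // innerRank r ≤ n} →₀ S :=
    (e.coeff.subtypeDomain fun r => innerRank r ≤ n).mapRange Subtype.val rfl
  refine ⟨s, fun f x => ?_⟩
  rw [← hfix.algEval x f, Finsupp.sum_mapRange_index (by simp), algEval_apply]
  exact (Finsupp.sum_subtypeDomain_index (h := fun r c => c • f (matAct r x))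
    fun r hr => (he r hr).innerRank_le).symm
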